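/- Let $\mathcal D^{(1)},\dots,\mathcal D^{(K)}$ be directed acyclic graphs (DAGs) on the same finite vertex set $V$. For each $j$ and each $v\in V$ let $p^{(j)}(x_v\mid x_{\mathrm{pa}_{\mathcal D^{(j)}}(v)})$ be a conditional distribution of a variable $X_v$ given the variables at the parents of $v$ in $\mathcal D^{(j)}$; these are the factors of the distribution $p^{(j)}$ of the $j$-th component. Let $V_{\mathrm{INV}}\subseteq V$ be the set of vertices $v$ for which these conditional distributions coincide for all $j$, where coinciding includes that the parent sets $\mathrm{pa}_{\mathcal D^{(j)}}(v)$ coincide. *Mixture DAG.* Let $v^{(j)}$ be a copy of $v$ for each $j$, and for $A\subseteq V$ put $[A]=\{v^{(j)}: v\in A,\ 1\le j\le K\}$. The mixture DAG $\mathcal D_\mu$ has vertex set $[V]\cup\{y\}$, the edges $u^{(j)}\to v^{(j)}$ for all $j$ and all edges $u\to v$ of $\mathcal D^{(j)}$, and the edges $y\to v^{(j)}$ for all $j$ and all $v\in V\setminus V_{\mathrm{INV}}$. Let $\widetilde{\mathcal D}^{(j)}$ be the sub-DAG that $\mathcal D_\mu$ induces on $V^{(j)}\cup\{y\}$, where $V^{(j)}=\{v^{(j)}:v\in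 V\}$. *Component MAGs.* $\mathcal M^{(j)}$ is the mixed graph (with directed and bidirected edges) on $V$ that is obtained by marginalizing $y$ out of $\widetilde{\mathcal D}^{(j)}$ as follows, with $v$ written for $v^{(j)}$. (0) Start with the directed edges of $\widetilde{\mathcal D}^{(j)}$ between vertices of $V$. (1) Add $u\leftrightarrow v$ for any two distinct children $u,v$ of $y$. (2) For all $t,u,v\in V$ such that $t\to u$ is an edge of $\widetilde{\mathcal D}^{(j)}$, $u\leftrightarrow v$ was added in (1), and $u$ is an ancestor of $v$ in $\widetilde{\mathcal D}^{(j)}$, add $t\to v$. (3) Whenever $u\leftrightarrow v$ was added in (1) and $u$ is an ancestor of $v$ in $\widetilde{\mathcal D}^{(j)}$, replace $u\leftrightarrow v$ by $u\to v$. *Union graph.* $\mathcal M_\cup$ is the mixed graph on $V$ in which $u\to v$ (respectively $u\leftrightarrow v$) is an edge if and only if it is an edge of $\mathcal M^{(j)}$ for some $j$. *d-separation.* In a mixed graph (a DAG being a mixed graph without bidirected edges), a path (without repeated vertices) is connecting given a set $C$ of vertices if each inner vertex of the path at which both neighbouring edges of the path have an arrowhead lies in $C$ or is an ancestor of a member of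 $C$, and no other inner vertex of the path lies in $C$. Disjoint sets $A$ and $B$ are d-separated given $C$ if no path between a vertex of $A$ and a vertex of $B$ is connecting given $C$. **Theorem.** Assume that $\mathcal M^{(1)},\dots,\mathcal M^{(K)}$ are compatible with the same poset, that is, there is a partial order $<_\pi$ on $V$ such that for all $j$: (a) if there is a directed path with at least one edge from $u$ to $v$ in $\mathcal M^{(j)}$, then $u<_\pi v$; and (b) if $u\leftrightarrow v$ in $\mathcal M^{(j)}$, then neither $u<_\pi v$ nor $v<_\pi u$. Then for all pairwise disjoint $A,B,C\subseteq V$, the sets $A$ and $B$ are d-separated given $C$ in $\mathcal M_\cup$ if and only if $[A]$ and $[B]$ are d-separated given $[C]$ in $\mathcal D_\mu$. -/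

import Mathlib

open MeasureTheory ProbabilityTheory

/-! ### Mixed graphs, paths and d-separation -/

/-- A mixed graph `(V, D, B)` with directed edges `dir u v` (`u → v`) and
bidirected edges `bi u v` (`u ↔ v`). -/
structure MixedGraph (V : Type*) where
  dir : V → V → Prop
  bi : V → V → Prop
  bi_symm : ∀ u v, bi u v → bi v u

/-- The type of an edge between `u` and `v`, as met by a walk that passes from `u` to `v`:
`u → v`, `u ← v` or `u ↔ v`. -/
inductive EdgeKind
  | fwd
  | bwd
  | both

namespace EdgeKind

/-- The edge has an arrowhead at the vertex the walk enters through it. -/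
def HeadAtEnd : EdgeKind → Prop
  | fwd => True
  | bwd => False
  | both => True

/-- The edge has an arrowhead at the vertex the walk leaves through it. -/
def HeadAtStart : EdgeKind → Prop
  | fwd => False
  | bwd => True
  | both => True

end EdgeKind

namespace MixedGraph

variable {V : Type*}

/-- `G.Step k u v`: the graph has an edge of kind `k` between `u` and `v`. -/
def Step (G : MixedGraph V) : EdgeKind → V → V → Prop
  | .fwd, u, v => G.dir u v
  | .bwd, u, v => G.dir v u
  | .both, u, v => G.bi u v

/-- `u` is a proper ancestor of `v`: there is a directed path with at least one edge
from `u` to `v`. -/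
def ProperAncestor (G : MixedGraph V) (u v : V) : Prop := Relation.TransGen G.dir u v

/-- `v` is a member of `C` or an ancestor of a member of `C`. -/
def IsAncestorOfSet (G : MixedGraph V) (C : Set V) (v : V) : Prop :=
  ∃ c ∈ C, Relation.ReflTransGen G.dir v c

/-- Walks in a mixed graph, that is, sequences of consecutive edges. -/
inductive Walk (G : MixedGraph V) : V → V → Type _
  | nil (v : V) : Walk G v v
  | cons {u v w : V} (k : EdgeKind) (h : G.Step k u v) (p : Walk G v w) : Walk G u w

namespace Walk

variable {G : MixedGraph V}

/-- The list of vertices of a walk, in order. -/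
def support : {u w : V} → G.Walk u w → List V
  | u, _, nil _ => [u]
  | u, _, cons _ _ p => u :: p.support

/-- A path is a walk without repeated vertices. -/
def IsPath {u w : V} (p : G.Walk u w) : Prop := p.support.Nodup

/-- A walk is connecting given `C` if each of its inner vertices `v` is active: if `v` is a
collider (both neighbouring edges have an arrowhead at `v`), then `v` belongs to `C` or is an
ancestor of a member of `C`; if `v` is not a collider, then `v` does not belong to `C`. -/
def Connecting (C : Set V) : {u w : V} → G.Walk u w → Prop
  | _, _, nil _ => True
  | _, _, cons _ _ (nil _) => True
  | _, _, cons (v := v) k _ (cons l h q) =>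
      ((k.HeadAtEnd ∧ l.HeadAtStart → G.IsAncestorOfSet C v) ∧
        (¬ (k.HeadAtEnd ∧ l.HeadAtStart) → v ∉ C)) ∧
      Connecting C (cons l h q)

end Walk

/-- `A` and `B` are d-separated given `C` in the mixed graph `G`: no path between a vertex
of `A` and a vertex of `B` is connecting given `C`. -/
def DSep (G : MixedGraph V) (A B C : Set V) : Prop :=
  ∀ a ∈ A, ∀ b ∈ B, ∀ p : G.Walk a b, p.IsPath → ¬ p.Connecting C

/-- There is a partial order `π` on `V` such that, in each graph `M j` of the family, proper
ancestors are `π`-smaller, and the endpoints of a bidirected edge are not `π`-comparable. -/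
def CompatibleWithSamePoset {ι : Type*} (M : ι → MixedGraph V) : Prop :=
  ∃ π : PartialOrder V, ∀ j,
    (∀ u v, (M j).ProperAncestor u v → π.lt u v) ∧
    (∀ u v, (M j).bi u v → ¬ π.lt u v ∧ ¬ π.lt v u)

/-- The union of a family of mixed graphs on the same vertices. -/
def union {ι : Type*} (M : ι → MixedGraph V) : MixedGraph V where
  dir u v := ∃ j, (M j).dir u v
  bi u v := ∃ j, (M j).bi u v
  bi_symm u v := fun ⟨j, h⟩ => ⟨j, (M j).bi_symm u v h⟩

end MixedGraph

/-! ### Directed acyclic graphs -/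

/-- A directed acyclic graph with vertex set `V`; `edge u v` means `u → v`. -/
structure DirAcyclicGraph (V : Type*) where
  edge : V → V → Prop
  acyclic : ∀ v, ¬ Relation.TransGen edge v v

namespace DirAcyclicGraph

variable {V W : Type*}

/-- A DAG as a mixed graph without bidirected edges. -/
def toMixedGraph (D : DirAcyclicGraph V) : MixedGraph V where
  dir := D.edge
  bi _ _ := False
  bi_symm _ _ h := h

/-- `u` is an ancestor of `v`. -/
def Ancestor (D : DirAcyclicGraph V) (u v : V) : Prop := Relation.TransGen D.edge u v

/-- The subgraph that `D` induces on the vertices of the form `f w`, with `f w` written as `w`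
(used for injective `f`). -/
def induce (D : DirAcyclicGraph V) (f : W → V) : DirAcyclicGraph W where
  edge a b := D.edge (f a) (f b)
  acyclic w h := D.acyclic (f w) (h.lift f (fun _ _ hab => hab))

/-- The marginal ancestral graph of a DAG on `V ∪ {y}` with respect to the vertex `y`, which
has in-degree zero; `y` is `none`, and `v ∈ V` is `some v`. The graph starts with the edges of
`D` among the vertices of `V`.
(1) `u ↔ v` is added for any two distinct children `u`, `v` of `y`.
(2) If `t → u` in `D`, `u ↔ v` was added in (1), and `u` is an ancestor of `v`, then `t → v`
is added.
(3) If `u ↔ v` was added in (1) and `u` is an ancestor of `v`, then `u ↔ v` is replaced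
by `u → v`. -/
def marginal (D : DirAcyclicGraph (Option V)) : MixedGraph V where
  dir t v :=
    D.edge (some t) (some v) ∨
    (∃ u, D.edge (some t) (some u) ∧
      (u ≠ v ∧ D.edge none (some u) ∧ D.edge none (some v)) ∧ D.Ancestor (some u) (some v)) ∨
    ((t ≠ v ∧ D.edge none (some t) ∧ D.edge none (some v)) ∧ D.Ancestor (some t) (some v))
  bi u v :=
    (u ≠ v ∧ D.edge none (some u) ∧ D.edge none (some v)) ∧
      ¬ D.Ancestor (some u) (some v) ∧ ¬ D.Ancestor (some v) (some u)
  bi_symm _ _ := fun ⟨⟨hne, hu, hv⟩, h₁, h₂⟩ => ⟨⟨hne.symm, hv, hu⟩, h₂, h₁⟩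

end DirAcyclicGraph

/-! ### Mixtures of DAG models -/

/-- A DAG model for random variables `X_v` with values in `X v`: a DAG on `V` together with the
factors of its joint distribution, namely, for each vertex `v`, the conditional distribution
`p(x_v | x_pa(v))` of `X_v` given the values of the variables at the parents of `v`. -/
structure DAGModel {V : Type*} (X : V → Type*) [∀ v, MeasurableSpace (X v)] where
  dag : DirAcyclicGraph V
  cond : ∀ v, Kernel (∀ u : {u // dag.edge u v}, X u) (X v)
  isMarkov : ∀ v, IsMarkovKernel (cond v)

namespace DAGModel

variable {V : Type*} {X : V → Type*} [∀ v, MeasurableSpace (X v)]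

/-- The conditional distributions of `X_v` given its parents are the same in both models: the
parents are the same, and so is the distribution of `X_v` given any values of the parents. -/
def SameConditional (P Q : DAGModel X) (v : V) : Prop :=
  (∀ u, P.dag.edge u v ↔ Q.dag.edge u v) ∧
  ∀ x : ∀ u, X u, P.cond v (fun u => x u) = Q.cond v (fun u => x u)

/-- `V_INV`: the vertices whose conditional distribution does not vary across the models. -/
def invariantNodes {K : ℕ} (P : Fin K → DAGModel X) : Set V :=
  {v | ∀ j k, SameConditional (P j) (P k) v}

/-- The edges of the mixture DAG. Its vertex `y` is `none`, and the copy `v^(j)` of `v ∈ V` in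
the `j`-th component is `some (j, v)`. -/
inductive MixtureEdge {K : ℕ} (P : Fin K → DAGModel X) :
    Option (Fin K × V) → Option (Fin K × V) → Prop
  | component (j : Fin K) (u v : V) (h : (P j).dag.edge u v) :
      MixtureEdge P (some (j, u)) (some (j, v))
  | mixing (j : Fin K) (v : V) (h : v ∉ invariantNodes P) :
      MixtureEdge P none (some (j, v))

theorem transGen_mixtureEdge_some {K : ℕ} (P : Fin K → DAGModel X) {j : Fin K} {u : V}
    {b : Option (Fin K × V)} (h : Relation.TransGen (MixtureEdge P) (some (j, u)) b) :
    ∃ v, b = some (j, v) ∧ Relation.TransGen (P j).dag.edge u v := by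
  induction h with
  | single h =>
    cases h with
    | component _ _ v h => exact ⟨v, rfl, .single h⟩
  | tail _ h ih =>
    obtain ⟨w, rfl, hw⟩ := ih
    cases h with
    | component _ _ v h => exact ⟨v, rfl, hw.tail h⟩

theorem transGen_mixtureEdge_none {K : ℕ} (P : Fin K → DAGModel X)
    {a : Option (Fin K × V)} : ¬ Relation.TransGen (MixtureEdge P) a none := by
  intro h
  obtain ⟨_, _, h⟩ := Relation.TransGen.tail'_iff.1 h
  cases h

/-- The mixture DAG `D_μ` on `[V] ∪ {y}`. -/
def mixtureDAG {K : ℕ} (P : Fin K → DAGModel X) : DirAcyclicGraph (Option (Fin K × V)) where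
  edge := MixtureEdge P
  acyclic := by
    rintro (_ | ⟨j, v⟩) h
    · exact transGen_mixtureEdge_none P h
    · obtain ⟨w, hw, h'⟩ := transGen_mixtureEdge_some P h
      obtain rfl : v = w := congrArg Prod.snd (Option.some.inj hw)
      exact (P j).dag.acyclic v h'

/-- The sub-DAG of the mixture DAG that is induced on `V^(j) ∪ {y}`; its vertices are
written as `some v` for `v^(j)` and `none` for `y`. -/
def extendedDAG {K : ℕ} (P : Fin K → DAGModel X) (j : Fin K) : DirAcyclicGraph (Option V) :=
  (mixtureDAG P).induce (Option.map (fun v => (j, v)))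

/-- The component MAG `M^(j)`. -/
def componentMAG {K : ℕ} (P : Fin K → DAGModel X) (j : Fin K) : MixedGraph V :=
  (extendedDAG P j).marginal

/-- The union graph `M_∪`. -/
def unionGraph {K : ℕ} (P : Fin K → DAGModel X) : MixedGraph V :=
  MixedGraph.union (componentMAG P)

end DAGModel

/-- `[A]`: all copies in the mixture DAG of the vertices in `A`. -/
def allCopies {V : Type*} (K : ℕ) (A : Set V) : Set (Option (Fin K × V)) :=
  {b | ∃ j, ∃ v ∈ A, b = some (j, v)}

/-! ### d-connection by reachability -/

namespace MixedGraph

variable {V : Type*}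

/-! Both separations become statements about active walks (`dSep_iff_not_reach`), which can be
translated edge by edge without regard to repeated vertices.

Two facts make the components comparable. An invariant vertex has the same parents in every
component and gains no others by marginalization. A non-invariant vertex, that is, a child of `y`,
has by compatibility the same descendants in every component (`reflTransGen_edge_of_compatible`).

From the mixture DAG to the union graph, a passage `u ← y → v` becomes the marginal edge between `u`
and `v`. If this edge has a tail at a vertex of `C`, that vertex blocks it, and the edges added by
rule (2) bypass the vertex. `Launch` and `Projected` keep the bypasses available
(`projected_of_reach`).

From the union graph to the mixture DAG, consecutive edges may come from different components. Edges
into invariant vertices exist in all components, so the walk is copied in all of them at once. At a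
child of `y`, either `y` can be reached, which gives access to every component, or the walk descends
from a child of `y` that is not an ancestor of `C`. Below such a vertex no collider can be opened,
so the walk descends to its end, and this descent can be made in a single component. `Lifted`
records these cases (`lifted_of_reach`). -/

/-- A walk that has arrived at `v`, with an arrowhead at `v` iff `h`, may leave `v` through an edge
that has an arrowhead at `v`. -/
def Opens (G : MixedGraph V) (C : Set V) (h : Bool) (v : V) : Prop :=
  if h then G.IsAncestorOfSet C v else v ∉ C

/-- `G.Reach S C v h`: some walk from `S` to `v`, active given `C`, arrives at `v` with an
arrowhead (`h = true`) or a tail (`h = false`). -/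
inductive Reach (G : MixedGraph V) (S C : Set V) : V → Bool → Prop
  | base {s : V} (hs : s ∈ S) : Reach G S C s false
  | fwd {v w : V} {h : Bool} (hv : Reach G S C v h) (hC : v ∉ C) (e : G.dir v w) :
      Reach G S C w true
  | bwd {v w : V} {h : Bool} (hv : Reach G S C v h) (hC : G.Opens C h v) (e : G.dir w v) :
      Reach G S C w false
  | bi {v w : V} {h : Bool} (hv : Reach G S C v h) (hC : G.Opens C h v) (e : G.bi v w) :
      Reach G S C w true

/-- An active walk reaches `v` and may leave it through an edge with an arrowhead at `v`. -/
def Free (G : MixedGraph V) (S C : Set V) (v : V) : Prop :=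
  ∃ h, G.Reach S C v h ∧ G.Opens C h v

theorem IsAncestorOfSet.of_reflTransGen {G : MixedGraph V} {C : Set V} {u v : V}
    (hv : G.IsAncestorOfSet C v) (h : Relation.ReflTransGen G.dir u v) :
    G.IsAncestorOfSet C u :=
  let ⟨c, hc, hvc⟩ := hv
  ⟨c, hc, h.trans hvc⟩

/-- Retraced from `v`, the walk follows directed edges until the first collider, which is an
ancestor of `C`, or until its start in `S`. -/
theorem Reach.isAncestorOfSet_or {G : MixedGraph V} {S C : Set V} {v : V} {h : Bool}
    (hv : G.Reach S C v h) :
    h = false → G.IsAncestorOfSet C v ∨ G.IsAncestorOfSet S v := by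
  induction hv with
  | base hs => exact fun _ => .inr ⟨_, hs, .refl⟩
  | fwd => exact fun h => by cases h
  | bi => exact fun h => by cases h
  | @bwd v w h hv hC e ih =>
    intro _
    cases h with
    | false => exact (ih rfl).imp (·.of_reflTransGen (.single e)) (·.of_reflTransGen (.single e))
    | true => exact .inl (IsAncestorOfSet.of_reflTransGen hC (.single e))

/-! ### Connecting paths versus active walks -/

namespace Walk

variable {G : MixedGraph V}

/-- Whether the first edge of the walk has an arrowhead at the first vertex. -/
def HeadAtFirst : {u w : V} → G.Walk u w → Prop
  | _, _, nil _ => False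
  | _, _, cons k _ _ => k.HeadAtStart

/-- The endpoint, being outside `C`, passes the test for a non-collider, so the one-edge walk needs
no separate rule. -/
theorem connecting_cons {C : Set V} {u v w : V} (hw : w ∉ C) (k : EdgeKind) (h : G.Step k u v)
    (p : G.Walk v w) :
    (cons k h p).Connecting C ↔
      ((k.HeadAtEnd ∧ p.HeadAtFirst → G.IsAncestorOfSet C v) ∧
        (¬ (k.HeadAtEnd ∧ p.HeadAtFirst) → v ∉ C)) ∧ p.Connecting C := by
  cases p with
  | nil => simp [Connecting, HeadAtFirst, hw]
  | cons l h' q => simp only [Connecting, HeadAtFirst]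

theorem Connecting.reach {S C : Set V} {v b : V} {p : G.Walk v b} (hp : p.Connecting C)
    (hb : b ∈ S) (hbC : b ∉ C) : ∃ h : Bool, G.Reach S C v h ∧ (h = true ↔ p.HeadAtFirst) := by
  induction p with
  | nil v => exact ⟨false, .base hb, by simp [HeadAtFirst]⟩
  | cons k e p ih =>
    rw [connecting_cons hbC] at hp
    obtain ⟨⟨h₁, h₂⟩, hp⟩ := hp
    obtain ⟨h, hr, hh⟩ := ih hp hb hbC
    rw [← hh] at h₁ h₂
    cases k with
    | fwd =>
      refine ⟨false, hr.bwd ?_ e, by simp [HeadAtFirst, EdgeKind.HeadAtStart]⟩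
      cases h <;> simp_all [Opens, EdgeKind.HeadAtEnd]
    | bwd =>
      exact ⟨true, hr.fwd (h₂ (by simp [EdgeKind.HeadAtEnd])) e,
        by simp [HeadAtFirst, EdgeKind.HeadAtStart]⟩
    | both =>
      refine ⟨true, hr.bi ?_ (G.bi_symm _ _ e), by simp [HeadAtFirst, EdgeKind.HeadAtStart]⟩
      cases h <;> simp_all [Opens, EdgeKind.HeadAtEnd]

/-- If the suffix begins with an arrowhead at `w`, retrace `p` from `w`: the edges are directed
towards `v` until a collider, which is an ancestor of `C`, or until `v` itself. -/
theorem Connecting.exists_suffix {C : Set V} {v b w : V} {p : G.Walk v b} (hp : p.Connecting C)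
    (hpath : p.IsPath) (hbC : b ∉ C) (hw : w ∈ p.support) :
    ∃ q : G.Walk w b, q.IsPath ∧ q.Connecting C ∧
      (¬ q.HeadAtFirst → w ∉ C ∨ w = v ∧ ¬ p.HeadAtFirst) ∧
      (q.HeadAtFirst → G.IsAncestorOfSet C w ∨
        p.HeadAtFirst ∧ Relation.ReflTransGen G.dir w v) := by
  induction p with
  | nil v =>
    obtain rfl : w = v := by simpa [support] using hw
    exact ⟨nil w, hpath, hp, fun h => .inr ⟨rfl, h⟩, fun h => .inr ⟨h, .refl⟩⟩
  | @cons v x b k e p ih =>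
    by_cases hwv : w = v
    · subst hwv
      exact ⟨cons k e p, hpath, hp, fun h => .inr ⟨rfl, h⟩, fun h => .inr ⟨h, .refl⟩⟩
    have hw' : w ∈ p.support := by simpa [support, hwv] using hw
    rw [connecting_cons hbC] at hp
    obtain ⟨⟨h₁, h₂⟩, hp⟩ := hp
    obtain ⟨q, hq, hqC, hq₁, hq₂⟩ := ih hp (List.nodup_cons.1 hpath).2 hbC hw'
    refine ⟨q, hq, hqC, fun h => .inl ?_, fun h => ?_⟩
    · rcases hq₁ h with h | ⟨rfl, h⟩
      · exact h
      · exact h₂ fun h' => h h'.2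
    · rcases hq₂ h with h | ⟨hx, hwx⟩
      · exact .inl h
      · cases k with
        | bwd => exact .inr ⟨trivial, hwx.tail e⟩
        | fwd => exact .inl ((h₁ ⟨trivial, hx⟩).of_reflTransGen hwx)
        | both => exact .inl ((h₁ ⟨trivial, hx⟩).of_reflTransGen hwx)

/-- If `w` already lies on the path, the loop is cut off. This may change the mark at `w`, but only
to one for which every continuation allowed before remains active. -/
theorem exists_path_cons {C : Set V} {v b w : V} {p : G.Walk v b} (hp : p.Connecting C)
    (hpath : p.IsPath) (hbC : b ∉ C) (k : EdgeKind) (e : G.Step k w v)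
    (h₁ : k.HeadAtEnd ∧ p.HeadAtFirst → G.IsAncestorOfSet C v)
    (h₂ : ¬ (k.HeadAtEnd ∧ p.HeadAtFirst) → v ∉ C) :
    ∃ q : G.Walk w b, q.IsPath ∧ q.Connecting C ∧
      ((q.HeadAtFirst ↔ k.HeadAtStart) ∨ ¬ q.HeadAtFirst ∧ w ∉ C ∨
        q.HeadAtFirst ∧ G.IsAncestorOfSet C w) := by
  by_cases hw : w ∈ p.support
  · obtain ⟨q, hq, hqC, hq₁, hq₂⟩ := hp.exists_suffix hpath hbC hw
    refine ⟨q, hq, hqC, ?_⟩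
    by_cases hqh : q.HeadAtFirst
    · rcases hq₂ hqh with h | ⟨hph, hwv⟩
      · exact .inr (.inr ⟨hqh, h⟩)
      · cases k with
        | fwd => exact .inr (.inr ⟨hqh, (h₁ ⟨trivial, hph⟩).of_reflTransGen hwv⟩)
        | bwd => exact .inl (iff_of_true hqh trivial)
        | both => exact .inl (iff_of_true hqh trivial)
    · rcases hq₁ hqh with h | ⟨rfl, hph⟩
      · exact .inr (.inl ⟨hqh, h⟩)
      · exact .inr (.inl ⟨hqh, h₂ fun h => hph h.2⟩)
  · exact ⟨cons k e p, List.nodup_cons.2 ⟨hw, hpath⟩,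
      (connecting_cons hbC k e p).2 ⟨⟨h₁, h₂⟩, hp⟩, .inl Iff.rfl⟩

end Walk

theorem Reach.exists_path {G : MixedGraph V} {S C : Set V} (hSC : Disjoint S C) {v : V} {h : Bool}
    (hv : G.Reach S C v h) : ∃ b ∈ S, ∃ p : G.Walk v b, p.IsPath ∧ p.Connecting C ∧
      ((p.HeadAtFirst ↔ h = true) ∨ ¬ p.HeadAtFirst ∧ v ∉ C ∨
        p.HeadAtFirst ∧ G.IsAncestorOfSet C v) := by
  induction hv with
  | @base s hs =>
    exact ⟨s, hs, .nil s, List.nodup_singleton s, trivial, .inl (by simp [Walk.HeadAtFirst])⟩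
  | @fwd v w h hv hC e ih =>
    obtain ⟨b, hb, p, hp, hpC, -⟩ := ih
    obtain ⟨q, hq, hqC, hqh⟩ := Walk.exists_path_cons hpC hp (hSC.notMem_of_mem_left hb)
      .bwd e (fun h => h.1.elim) (fun _ => hC)
    exact ⟨b, hb, q, hq, hqC, by simpa [EdgeKind.HeadAtStart] using hqh⟩
  | @bwd v w h hv hC e ih =>
    obtain ⟨b, hb, p, hp, hpC, hph⟩ := ih
    obtain ⟨q, hq, hqC, hqh⟩ := Walk.exists_path_cons hpC hp (hSC.notMem_of_mem_left hb)
      .fwd e (by cases h <;> simp_all [Opens]; tauto)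
      (by cases h <;> simp_all [Opens, EdgeKind.HeadAtEnd]; tauto)
    exact ⟨b, hb, q, hq, hqC, by simpa [EdgeKind.HeadAtStart] using hqh⟩
  | @bi v w h hv hC e ih =>
    obtain ⟨b, hb, p, hp, hpC, hph⟩ := ih
    obtain ⟨q, hq, hqC, hqh⟩ := Walk.exists_path_cons hpC hp (hSC.notMem_of_mem_left hb)
      .both (G.bi_symm _ _ e) (by cases h <;> simp_all [Opens]; tauto)
      (by cases h <;> simp_all [Opens, EdgeKind.HeadAtEnd]; tauto)
    exact ⟨b, hb, q, hq, hqC, by simpa [EdgeKind.HeadAtStart] using hqh⟩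

theorem dSep_iff_not_reach (G : MixedGraph V) {A B C : Set V} (hBC : Disjoint B C) :
    G.DSep A B C ↔ ∀ a ∈ A, ∀ h, ¬ G.Reach B C a h := by
  constructor
  · intro H a ha h hr
    obtain ⟨b, hb, p, hp, hpC, -⟩ := hr.exists_path hBC
    exact H a ha b hb p hp hpC
  · intro H a ha b hb p _ hpC
    obtain ⟨h, hr, -⟩ := hpC.reach hb (hBC.notMem_of_mem_left hb)
    exact H a ha h hr

end MixedGraph

/-! ### Edges and ancestors in the mixture DAG and in the union graph -/

namespace DAGModel

open Relation

variable {V : Type*} {X : V → Type*} [∀ v, MeasurableSpace (X v)] {K : ℕ}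
  {P : Fin K → DAGModel X}

theorem mixtureEdge_some_some_iff {j k : Fin K} {u v : V} :
    MixtureEdge P (some (j, u)) (some (k, v)) ↔ j = k ∧ (P j).dag.edge u v := by
  constructor
  · rintro ⟨⟩
    exact ⟨rfl, by assumption⟩
  · rintro ⟨rfl, h⟩
    exact .component j u v h

theorem mixtureEdge_none_some_iff {k : Fin K} {v : V} :
    MixtureEdge P none (some (k, v)) ↔ v ∉ invariantNodes P := by
  constructor
  · rintro ⟨⟩
    assumption
  · exact .mixing k v

theorem extendedDAG_edge_some_some {j : Fin K} {u v : V} :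
    (extendedDAG P j).edge (some u) (some v) ↔ (P j).dag.edge u v :=
  mixtureEdge_some_some_iff.trans (and_iff_right rfl)

theorem extendedDAG_edge_none_some {j : Fin K} {v : V} :
    (extendedDAG P j).edge none (some v) ↔ v ∉ invariantNodes P :=
  mixtureEdge_none_some_iff

theorem extendedDAG_ancestor {j : Fin K} {u v : V} :
    (extendedDAG P j).Ancestor (some u) (some v) ↔ TransGen (P j).dag.edge u v := by
  constructor
  · intro h
    have h' : TransGen (MixtureEdge P) (some (j, u)) (some (j, v)) :=
      h.lift (Option.map (fun v => (j, v))) (fun _ _ h => h)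
    obtain ⟨w, hw, h'⟩ := transGen_mixtureEdge_some P h'
    obtain rfl : v = w := congrArg Prod.snd (Option.some.inj hw)
    exact h'
  · exact fun h => h.lift some fun _ _ h => extendedDAG_edge_some_some.2 h

theorem componentMAG_dir {j : Fin K} {t v : V} :
    (componentMAG P j).dir t v ↔ (P j).dag.edge t v ∨
      (∃ u, (P j).dag.edge t u ∧ (u ≠ v ∧ u ∉ invariantNodes P ∧ v ∉ invariantNodes P) ∧
        TransGen (P j).dag.edge u v) ∨
      ((t ≠ v ∧ t ∉ invariantNodes P ∧ v ∉ invariantNodes P) ∧ TransGen (P j).dag.edge t v) := by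
  simp only [componentMAG, DirAcyclicGraph.marginal, extendedDAG_edge_some_some,
    extendedDAG_edge_none_some, extendedDAG_ancestor]

theorem componentMAG_bi {j : Fin K} {u v : V} :
    (componentMAG P j).bi u v ↔ (u ≠ v ∧ u ∉ invariantNodes P ∧ v ∉ invariantNodes P) ∧
      ¬ TransGen (P j).dag.edge u v ∧ ¬ TransGen (P j).dag.edge v u := by
  simp only [componentMAG, DirAcyclicGraph.marginal,
    extendedDAG_edge_none_some, extendedDAG_ancestor]

theorem ne_of_transGen_edge {j : Fin K} {u v : V} (h : TransGen (P j).dag.edge u v) : u ≠ v := by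
  rintro rfl
  exact (P j).dag.acyclic u h

theorem edge_of_mem_invariantNodes {v : V} (hv : v ∈ invariantNodes P) {j : Fin K} (k : Fin K)
    {u : V} (h : (P j).dag.edge u v) : (P k).dag.edge u v :=
  ((hv j k).1 u).1 h

theorem unionGraph_dir_of_edge {j : Fin K} {u v : V} (h : (P j).dag.edge u v) :
    (unionGraph P).dir u v :=
  ⟨j, componentMAG_dir.2 (.inl h)⟩

theorem unionGraph_dir_of_transGen {j : Fin K} {u v : V} (hu : u ∉ invariantNodes P)
    (hv : v ∉ invariantNodes P) (h : TransGen (P j).dag.edge u v) : (unionGraph P).dir u v :=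
  ⟨j, componentMAG_dir.2 (.inr (.inr ⟨⟨ne_of_transGen_edge h, hu, hv⟩, h⟩))⟩

theorem unionGraph_dir_of_edge_of_transGen {j : Fin K} {t u v : V} (htu : (P j).dag.edge t u)
    (hu : u ∉ invariantNodes P) (hv : v ∉ invariantNodes P) (h : TransGen (P j).dag.edge u v) :
    (unionGraph P).dir t v :=
  ⟨j, componentMAG_dir.2 (.inr (.inl ⟨u, htu, ⟨ne_of_transGen_edge h, hu, hv⟩, h⟩))⟩

/-- Marginalization adds edges only into children of `y`, and an invariant vertex has the same
parents in all components. -/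
theorem edge_of_unionGraph_dir {t v : V} (h : (unionGraph P).dir t v) (hv : v ∈ invariantNodes P)
    (k : Fin K) : (P k).dag.edge t v := by
  obtain ⟨j, h⟩ := h
  rcases componentMAG_dir.1 h with h | ⟨_, _, h, _⟩ | ⟨h, _⟩
  · exact edge_of_mem_invariantNodes hv k h
  · exact (h.2.2 hv).elim
  · exact (h.2.2 hv).elim

theorem unionGraph_dir_cases {t v : V} (h : (unionGraph P).dir t v) (hv : v ∉ invariantNodes P) :
    ∃ k, (∃ u ∉ invariantNodes P, (P k).dag.edge t u ∧ ReflTransGen (P k).dag.edge u v) ∨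
      (t ∉ invariantNodes P ∧ TransGen (P k).dag.edge t v) := by
  obtain ⟨j, h⟩ := h
  refine ⟨j, ?_⟩
  rcases componentMAG_dir.1 h with h | ⟨u, htu, ⟨_, hu, _⟩, huv⟩ | ⟨⟨_, ht, _⟩, h⟩
  · exact .inl ⟨v, hv, h, .refl⟩
  · exact .inl ⟨u, hu, htu, huv.to_reflTransGen⟩
  · exact .inr ⟨ht, h⟩

theorem transGen_of_unionGraph_dir {t v : V} (h : (unionGraph P).dir t v) :
    ∃ j, TransGen (P j).dag.edge t v := by
  obtain ⟨j, h⟩ := h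
  refine ⟨j, ?_⟩
  rcases componentMAG_dir.1 h with h | ⟨u, htu, _, huv⟩ | ⟨_, h⟩
  · exact .single h
  · exact .head htu huv
  · exact h

theorem unionGraph_bi_notMem {u v : V} (h : (unionGraph P).bi u v) :
    u ∉ invariantNodes P ∧ v ∉ invariantNodes P :=
  let ⟨_, h⟩ := h
  (componentMAG_bi.1 h).1.2

theorem reflTransGen_unionGraph {j : Fin K} {u v : V} (h : ReflTransGen (P j).dag.edge u v) :
    ReflTransGen (unionGraph P).dir u v :=
  h.lift id fun _ _ => unionGraph_dir_of_edge

/-- Compatibility makes the ancestor relation among the children of `y` the same in all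
components. -/
theorem transGen_edge_of_compatible
    (hP : MixedGraph.CompatibleWithSamePoset (componentMAG P)) {u v : V}
    (hu : u ∉ invariantNodes P) (hv : v ∉ invariantNodes P) {j : Fin K} (k : Fin K)
    (h : TransGen (P j).dag.edge u v) : TransGen (P k).dag.edge u v := by
  obtain ⟨π, hπ⟩ := hP
  have key : ∀ {i : Fin K} {a b : V}, TransGen (P i).dag.edge a b → π.lt a b := fun h =>
    (hπ _).1 _ _ (h.lift id fun _ _ h => componentMAG_dir.2 (.inl h))
  -- Otherwise component `k` orders the pair the other way or joins it by a bidirected edge; the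
  -- poset forbids both.
  by_contra huv
  by_cases hvu : TransGen (P k).dag.edge v u
  · exact @lt_asymm V π.toPreorder _ _ (key h) (key hvu)
  · exact ((hπ k).2 u v (componentMAG_bi.2
      ⟨⟨ne_of_transGen_edge h, hu, hv⟩, huv, hvu⟩)).1 (key h)

/-- Up to the last non-invariant vertex of the path, children of `y` are compared; the edges after
it enter invariant vertices and are shared. -/
theorem reflTransGen_edge_of_compatible
    (hP : MixedGraph.CompatibleWithSamePoset (componentMAG P)) {u v : V}
    (hu : u ∉ invariantNodes P) {j : Fin K} (k : Fin K)
    (h : ReflTransGen (P j).dag.edge u v) : ReflTransGen (P k).dag.edge u v := by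
  induction h with
  | refl => exact .refl
  | @tail w v huw hwv ih =>
    by_cases hv : v ∈ invariantNodes P
    · exact ih.tail (edge_of_mem_invariantNodes hv k hwv)
    · exact (transGen_edge_of_compatible hP hu hv k (TransGen.tail' huw hwv)).to_reflTransGen

/-- The path is assembled from its end: an edge into an invariant vertex exists in the component in
use, and at a non-invariant vertex the rest of the path moves to the component of the incoming edge.
-/
theorem exists_reflTransGen_of_unionGraph [Nonempty (Fin K)]
    (hP : MixedGraph.CompatibleWithSamePoset (componentMAG P)) {u v : V}
    (h : ReflTransGen (unionGraph P).dir u v) : ∃ j, ReflTransGen (P j).dag.edge u v := by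
  induction h using ReflTransGen.head_induction_on with
  | refl => exact ⟨Classical.arbitrary _, .refl⟩
  | @head u w huw hwv ih =>
    obtain ⟨k, hk⟩ := ih
    by_cases hw : w ∈ invariantNodes P
    · exact ⟨k, .head (edge_of_unionGraph_dir huw hw k) hk⟩
    · obtain ⟨j, hj⟩ := transGen_of_unionGraph_dir huw
      exact ⟨j, hj.to_reflTransGen.trans (reflTransGen_edge_of_compatible hP hw j hk)⟩

theorem reflTransGen_of_unionGraph
    (hP : MixedGraph.CompatibleWithSamePoset (componentMAG P)) {u v : V}
    (hu : u ∉ invariantNodes P) (h : ReflTransGen (unionGraph P).dir u v) (k : Fin K) :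
    ReflTransGen (P k).dag.edge u v :=
  have : Nonempty (Fin K) := ⟨k⟩
  let ⟨_, hj⟩ := exists_reflTransGen_of_unionGraph hP h
  reflTransGen_edge_of_compatible hP hu k hj

theorem some_mem_allCopies {j : Fin K} {v : V} {A : Set V} :
    some (j, v) ∈ allCopies K A ↔ v ∈ A := by
  constructor
  · rintro ⟨k, w, hw, h⟩
    obtain ⟨rfl, rfl⟩ := Prod.mk.inj (Option.some.inj h)
    exact hw
  · exact fun h => ⟨j, v, h, rfl⟩

theorem none_notMem_allCopies {A : Set V} : none ∉ allCopies K A := by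
  rintro ⟨_, _, _, h⟩
  cases h

theorem disjoint_allCopies {A B : Set V} (h : Disjoint A B) :
    Disjoint (allCopies K A) (allCopies K B) := by
  refine Set.disjoint_left.2 ?_
  rintro _ ⟨j, v, hv, rfl⟩ h'
  exact h.notMem_of_mem_left hv (some_mem_allCopies.1 h')

theorem isAncestorOfSet_mixtureDAG {j : Fin K} {v : V} {C : Set V} :
    (mixtureDAG P).toMixedGraph.IsAncestorOfSet (allCopies K C) (some (j, v)) ↔
      ∃ c ∈ C, ReflTransGen (P j).dag.edge v c := by
  constructor
  · rintro ⟨_, ⟨k, c, hc, rfl⟩, h⟩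
    refine ⟨c, hc, ?_⟩
    rcases reflTransGen_iff_eq_or_transGen.1 h with h | h
    · obtain ⟨-, rfl⟩ := Prod.mk.inj (Option.some.inj h)
      exact .refl
    · obtain ⟨w, hw, h⟩ := transGen_mixtureEdge_some P h
      obtain ⟨-, rfl⟩ := Prod.mk.inj (Option.some.inj hw)
      exact h.to_reflTransGen
  · rintro ⟨c, hc, h⟩
    exact ⟨some (j, c), some_mem_allCopies.2 hc,
      h.lift (fun v => some (j, v)) fun _ _ h => MixtureEdge.component _ _ _ h⟩

theorem isAncestorOfSet_unionGraph_of_mixtureDAG {j : Fin K} {v : V} {C : Set V}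
    (h : (mixtureDAG P).toMixedGraph.IsAncestorOfSet (allCopies K C) (some (j, v))) :
    (unionGraph P).IsAncestorOfSet C v :=
  let ⟨c, hc, h⟩ := isAncestorOfSet_mixtureDAG.1 h
  ⟨c, hc, reflTransGen_unionGraph h⟩

/-- For a child of `y`, a collider open in the union graph is open in every component; invariant
vertices may lack this property. -/
theorem isAncestorOfSet_mixtureDAG_of_unionGraph
    (hP : MixedGraph.CompatibleWithSamePoset (componentMAG P)) {v : V} {C : Set V}
    (hv : v ∉ invariantNodes P) (h : (unionGraph P).IsAncestorOfSet C v) (j : Fin K) :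
    (mixtureDAG P).toMixedGraph.IsAncestorOfSet (allCopies K C) (some (j, v)) :=
  let ⟨c, hc, h⟩ := h
  isAncestorOfSet_mixtureDAG.2 ⟨c, hc, reflTransGen_of_unionGraph hP hv h j⟩

end DAGModel

/-! ### From the mixture DAG to the union graph -/

namespace DAGModel

open Relation

variable {V : Type*} {X : V → Type*} [∀ v, MeasurableSpace (X v)] {K : ℕ}
  {P : Fin K → DAGModel X} {S C : Set V}

/-- All children of `y` below `v` are reached with an arrowhead in the union graph. -/
def ReachesBelow (P : Fin K → DAGModel X) (S C : Set V) (v : V) : Prop :=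
  ∀ w ∉ invariantNodes P, ∀ j, TransGen (P j).dag.edge v w → (unionGraph P).Reach S C w true

/-- A child of `y` in the union graph from which an active walk may jump to the other ones. -/
def Launch (P : Fin K → DAGModel X) (S C : Set V) (u : V) : Prop :=
  u ∉ invariantNodes P ∧ (unionGraph P).Free S C u ∧ (u ∈ C → ReachesBelow P S C u)

/-- What an active walk to a vertex of the mixture DAG provides in the union graph. -/
def Projected (P : Fin K → DAGModel X) (S C : Set V) : Option (Fin K × V) → Bool → Prop
  | none, _ => ∃ u, Launch P S C u
  | some (_, v), false => (unionGraph P).Reach S C v false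
  | some (_, v), true =>
      ((unionGraph P).Reach S C v true ∧ (v ∉ invariantNodes P → v ∈ C → ReachesBelow P S C v)) ∨
      ((unionGraph P).Reach S C v false ∧ v ∉ C) ∨
      (v ∈ C ∧ v ∉ invariantNodes P ∧ ∃ u j, TransGen (P j).dag.edge v u ∧ Launch P S C u)

theorem Projected.exists_reach {j : Fin K} {v : V} {h : Bool}
    (hv : Projected P S C (some (j, v)) h) (hC : v ∉ C) :
    ∃ h', (unionGraph P).Reach S C v h' := by
  cases h with
  | false => exact ⟨_, hv⟩
  | true =>
    rcases hv with ⟨hv, _⟩ | ⟨hv, _⟩ | ⟨hv, _⟩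
    · exact ⟨_, hv⟩
    · exact ⟨_, hv⟩
    · exact (hC hv).elim

/-- Simulates the passage `u ← y → v`, according to whether `u` equals `v`, is above it, is below
it, or is incomparable to it. -/
theorem Launch.projected (hP : MixedGraph.CompatibleWithSamePoset (componentMAG P)) {u v : V}
    (hu : Launch P S C u) (hv : v ∉ invariantNodes P) (j : Fin K) :
    Projected P S C (some (j, v)) true := by
  obtain ⟨hu, ⟨h, hr, ho⟩, hb⟩ := hu
  by_cases hne : u = v
  · subst hne
    cases h with
    | false => exact .inr (.inl ⟨hr, ho⟩)
    | true => exact .inl ⟨hr, fun _ => hb⟩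
  have reach_of_lt : ∀ {w}, w ∉ invariantNodes P → ∀ i, TransGen (P i).dag.edge u w →
      (unionGraph P).Reach S C w true := by
    intro w hw i huw
    by_cases huC : u ∈ C
    · exact hb huC w hw i huw
    · exact hr.fwd huC (unionGraph_dir_of_transGen hu hw huw)
  by_cases huv : TransGen (P j).dag.edge u v
  · refine .inl ⟨reach_of_lt hv j huv, fun _ _ w hw i hvw => ?_⟩
    exact reach_of_lt hw j (huv.trans (transGen_edge_of_compatible hP hv hw j hvw))
  by_cases hvu : TransGen (P j).dag.edge v u
  · by_cases hvC : v ∈ C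
    -- The edge `u ← v` would lead to a blocked `v ∈ C`. The walk waits at `u`: a later step to a
    -- parent `t` of `v` uses the edge `t → u` of rule (2), and a return to `y` starts again from
    -- `u`.
    · exact .inr (.inr ⟨hvC, hv, u, j, hvu, hu, ⟨h, hr, ho⟩, hb⟩)
    · exact .inr (.inl ⟨hr.bwd ho (unionGraph_dir_of_transGen hv hu hvu), hvC⟩)
  refine .inl ⟨hr.bi ho ⟨j, componentMAG_bi.2 ⟨⟨hne, hu, hv⟩, huv, hvu⟩⟩, fun _ _ w hw i hvw => ?_⟩
  -- As `v` is not above `u`, neither is `w`, nor is `w` equal to `u`; hence `u → w` or `u ↔ w`.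
  replace hvw := transGen_edge_of_compatible hP hv hw j hvw
  by_cases huw : TransGen (P j).dag.edge u w
  · exact reach_of_lt hw j huw
  · refine hr.bi ho ⟨j, componentMAG_bi.2 ⟨⟨?_, hu, hw⟩, huw, fun hwu => hvu (hvw.trans hwu)⟩⟩
    rintro rfl
    exact hvu hvw

theorem projected_of_reach (hP : MixedGraph.CompatibleWithSamePoset (componentMAG P))
    {x : Option (Fin K × V)} {h : Bool}
    (hx : (mixtureDAG P).toMixedGraph.Reach (allCopies K S) (allCopies K C) x h) :
    Projected P S C x h := by
  induction hx with
  | base hs =>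
    obtain ⟨j, v, hv, rfl⟩ := hs
    exact MixedGraph.Reach.base hv
  | fwd _ hC e ih =>
    cases e with
    | component j t v e =>
      rw [some_mem_allCopies] at hC
      obtain ⟨h', ht⟩ := ih.exists_reach hC
      refine .inl ⟨ht.fwd hC (unionGraph_dir_of_edge e), fun hv _ w hw i hvw => ?_⟩
      -- Rule (2) gives `t → w`, which bypasses `v`.
      exact ht.fwd hC (unionGraph_dir_of_edge_of_transGen e hv hw
        (transGen_edge_of_compatible hP hv hw j hvw))
    | mixing k v hv =>
      obtain ⟨u, hu⟩ := ih
      exact hu.projected hP hv k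
  | @bwd x z h _ hC e ih =>
    cases e with
    | component j t v e =>
      cases h with
      | false =>
        exact MixedGraph.Reach.bwd (h := false) ih (fun h => hC (some_mem_allCopies.2 h))
          (unionGraph_dir_of_edge e)
      | true =>
        have hC' : (unionGraph P).IsAncestorOfSet C v :=
          isAncestorOfSet_unionGraph_of_mixtureDAG hC
        rcases ih with ⟨hv, _⟩ | ⟨hv, hvC⟩ | ⟨_, hv, u, i, hvu, hu, ⟨h', hr, ho⟩, _⟩
        · exact hv.bwd hC' (unionGraph_dir_of_edge e)
        · exact hv.bwd hvC (unionGraph_dir_of_edge e)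
        · exact hr.bwd ho (unionGraph_dir_of_edge_of_transGen e hv hu
            (transGen_edge_of_compatible hP hv hu j hvu))
    | mixing k v hv =>
      cases h with
      | false =>
        have hvC : v ∉ C := fun h => hC (some_mem_allCopies.2 h)
        exact ⟨v, hv, ⟨false, ih, hvC⟩, fun h => (hvC h).elim⟩
      | true =>
        have hC' : (unionGraph P).IsAncestorOfSet C v :=
          isAncestorOfSet_unionGraph_of_mixtureDAG hC
        rcases ih with ⟨hr, hb⟩ | ⟨hr, hvC⟩ | ⟨_, _, u, _, _, hu⟩
        · exact ⟨v, hv, ⟨true, hr, hC'⟩, hb hv⟩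
        · exact ⟨v, hv, ⟨false, hr, hvC⟩, fun h => (hvC h).elim⟩
        · exact ⟨u, hu⟩
  | bi _ _ e => exact e.elim

end DAGModel

/-! ### From the union graph to the mixture DAG -/

namespace DAGModel

open Relation

variable {V : Type*} {X : V → Type*} [∀ v, MeasurableSpace (X v)] {K : ℕ}
  {P : Fin K → DAGModel X} {S C : Set V}

/-- Reachability in the mixture DAG from the copies of `S`, given the copies of `C`. -/
abbrev MixReach (P : Fin K → DAGModel X) (S C : Set V) : Option (Fin K × V) → Bool → Prop :=
  (mixtureDAG P).toMixedGraph.Reach (allCopies K S) (allCopies K C)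

/-- The copy `v^(j)` is reached, and may be left through an edge with an arrowhead at `v^(j)`. -/
abbrev MixFree (P : Fin K → DAGModel X) (S C : Set V) (j : Fin K) (v : V) : Prop :=
  (mixtureDAG P).toMixedGraph.Free (allCopies K S) (allCopies K C) (some (j, v))

/-- The copy `v^(j)` is an ancestor of a copy of a member of `C`. -/
abbrev MixAnc (P : Fin K → DAGModel X) (C : Set V) (j : Fin K) (v : V) : Prop :=
  (mixtureDAG P).toMixedGraph.IsAncestorOfSet (allCopies K C) (some (j, v))

/-- The copy `v^(j)` is reached and, unless `v` is in `C`, may be left through any edge. -/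
def MixWeak (P : Fin K → DAGModel X) (S C : Set V) (j : Fin K) (v : V) : Prop :=
  MixReach P S C (some (j, v)) false ∨ MixReach P S C (some (j, v)) true ∧ MixAnc P C j v

/-- The edges of the `j`-th DAG whose tail is outside `C`. -/
def EdgeAvoiding (P : Fin K → DAGModel X) (C : Set V) (j : Fin K) (a b : V) : Prop :=
  (P j).dag.edge a b ∧ a ∉ C

/-! ### Moves of active walks in the mixture DAG -/

theorem MixReach.edge {j : Fin K} {v w : V} {h : Bool} (hv : MixReach P S C (some (j, v)) h)
    (hC : v ∉ C) (e : (P j).dag.edge v w) : MixReach P S C (some (j, w)) true :=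
  MixedGraph.Reach.fwd hv (mt some_mem_allCopies.1 hC) (MixtureEdge.component j v w e)

theorem MixReach.free {j : Fin K} {v : V} (hv : MixReach P S C (some (j, v)) true)
    (h : MixAnc P C j v) : MixFree P S C j v :=
  ⟨true, hv, h⟩

theorem MixFree.edge {j : Fin K} {v w : V} (hv : MixFree P S C j v)
    (e : (P j).dag.edge w v) : MixReach P S C (some (j, w)) false :=
  let ⟨_, hr, ho⟩ := hv
  MixedGraph.Reach.bwd hr ho (MixtureEdge.component j w v e)

theorem MixFree.none {j : Fin K} {v : V} (h : MixFree P S C j v) (hv : v ∉ invariantNodes P) :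
    MixReach P S C none false :=
  let ⟨_, hr, ho⟩ := h
  MixedGraph.Reach.bwd hr ho (MixtureEdge.mixing j v hv)

theorem MixReach.of_none (h : MixReach P S C none false) {v : V} (hv : v ∉ invariantNodes P)
    (j : Fin K) : MixReach P S C (some (j, v)) true :=
  MixedGraph.Reach.fwd h none_notMem_allCopies (MixtureEdge.mixing j v hv)

theorem MixFree.weak {j : Fin K} {v : V} (h : MixFree P S C j v) : MixWeak P S C j v := by
  obtain ⟨h, hr, ho⟩ := h
  cases h with
  | false => exact .inl hr
  | true => exact .inr ⟨hr, ho⟩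

theorem MixWeak.free {j : Fin K} {v : V} (h : MixWeak P S C j v) (hv : v ∉ C) :
    MixFree P S C j v := by
  rcases h with h | h
  · exact ⟨false, h, mt some_mem_allCopies.1 hv⟩
  · exact h.1.free h.2

theorem MixWeak.exists_reach {j : Fin K} {v : V} (h : MixWeak P S C j v) :
    ∃ h', MixReach P S C (some (j, v)) h' := by
  rcases h with h | h
  · exact ⟨_, h⟩
  · exact ⟨_, h.1⟩

theorem MixReach.path {j : Fin K} {v w : V} (hv : MixReach P S C (some (j, v)) true)
    (h : ReflTransGen (EdgeAvoiding P C j) v w) : MixReach P S C (some (j, w)) true := by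
  induction h with
  | refl => exact hv
  | tail _ e ih => exact MixReach.edge ih e.2 e.1

theorem MixFree.path {j : Fin K} {v w : V} (hw : MixFree P S C j w)
    (h : ReflTransGen (EdgeAvoiding P C j) v w) : MixFree P S C j v := by
  induction h using ReflTransGen.head_induction_on with
  | refl => exact hw
  | head e _ ih => exact ⟨false, MixFree.edge ih e.1, mt some_mem_allCopies.1 e.2⟩

theorem reflTransGen_edgeAvoiding {j : Fin K} {u w : V}
    (hu : ¬ (unionGraph P).IsAncestorOfSet C u) (h : ReflTransGen (P j).dag.edge u w) :
    ReflTransGen (EdgeAvoiding P C j) u w := by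
  induction h using ReflTransGen.head_induction_on with
  | refl => exact .refl
  | head e _ ih =>
    exact .head ⟨e, fun h => hu ⟨_, h, .refl⟩⟩
      (ih fun h => hu (h.of_reflTransGen (.single (unionGraph_dir_of_edge e))))

theorem exists_mixAnc [Nonempty (Fin K)]
    (hP : MixedGraph.CompatibleWithSamePoset (componentMAG P)) {v : V}
    (h : (unionGraph P).IsAncestorOfSet C v) : ∃ j, MixAnc P C j v :=
  let ⟨c, hc, h⟩ := h
  let ⟨j, h⟩ := exists_reflTransGen_of_unionGraph hP h
  ⟨j, isAncestorOfSet_mixtureDAG.2 ⟨c, hc, h⟩⟩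

/-- If `v` is an ancestor of `C` in one component only, then this is so through a child of `y`. -/
theorem exists_path_of_mixAnc {j k : Fin K} {v : V} (hk : MixAnc P C k v)
    (hj : ¬ MixAnc P C j v) : ∃ w ∉ invariantNodes P, MixAnc P C k w ∧
      ReflTransGen (EdgeAvoiding P C k) v w := by
  obtain ⟨c, hc, h⟩ := isAncestorOfSet_mixtureDAG.1 hk
  rw [MixAnc, isAncestorOfSet_mixtureDAG] at hj
  clear hk
  induction h using ReflTransGen.head_induction_on with
  | refl => exact (hj ⟨c, hc, .refl⟩).elim
  | @head v z e h ih =>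
    have hv : v ∉ C := fun h => hj ⟨v, h, .refl⟩
    -- If `z` is invariant, `v → z` is shared, so `z` is not an ancestor of `C` in component `j`
    -- either. The first non-invariant vertex after `v` is the one sought.
    by_cases hz : z ∈ invariantNodes P
    · obtain ⟨w, hw, hwC, hzw⟩ := ih fun ⟨c, hc, h⟩ =>
        hj ⟨c, hc, .head (edge_of_mem_invariantNodes hz j e) h⟩
      exact ⟨w, hw, hwC, .head ⟨e, hv⟩ hzw⟩
    · exact ⟨z, hz, isAncestorOfSet_mixtureDAG.2 ⟨c, hc, h⟩, .single ⟨e, hv⟩⟩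

/-- What an active walk to a vertex of the union graph provides in the mixture DAG. -/
def Lifted (P : Fin K → DAGModel X) (S C : Set V) (v : V) : Bool → Prop
  | false => (∃ j, MixWeak P S C j v) ∧ (MixReach P S C none false ∨ ∀ j, MixWeak P S C j v)
  | true =>
      (MixReach P S C none false ∧ ∃ j, MixReach P S C (some (j, v)) true) ∨
      (∀ j, MixReach P S C (some (j, v)) true) ∨
      ∃ j, ∃ u ∉ invariantNodes P, ¬ (unionGraph P).IsAncestorOfSet C u ∧
        ReflTransGen (unionGraph P).dir u v ∧ MixReach P S C (some (j, u)) true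

/-- In the descending case the path below `u` is carried out in component `j`; it avoids `C` because
`u` is not an ancestor of `C`. -/
theorem Lifted.exists_reach [Nonempty (Fin K)]
    (hP : MixedGraph.CompatibleWithSamePoset (componentMAG P)) {v : V} {h : Bool}
    (hv : Lifted P S C v h) : ∃ j h', MixReach P S C (some (j, v)) h' := by
  cases h with
  | false =>
    obtain ⟨⟨j, hv⟩, -⟩ := hv
    exact ⟨j, hv.exists_reach⟩
  | true =>
    rcases hv with ⟨_, j, hv⟩ | hv | ⟨j, u, hu, huC, huv, hr⟩
    · exact ⟨j, _, hv⟩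
    · exact ⟨Classical.arbitrary _, _, hv _⟩
    · exact ⟨j, _, hr.path (reflTransGen_edgeAvoiding huC (reflTransGen_of_unionGraph hP hu huv j))⟩

/-! ### Lifting a single edge of the union graph -/

theorem Lifted.of_none [Nonempty (Fin K)] (h : MixReach P S C none false) {w : V}
    (hw : w ∉ invariantNodes P) : Lifted P S C w true :=
  .inl ⟨h, Classical.arbitrary _, MixReach.of_none h hw _⟩

/-- Unless `y` is already reached, an edge into a child of `y` comes from a component path whose
start `v` or second vertex `u` is a child of `y`. If that vertex lets the walk pass to `y`, all
components are accessible; otherwise the final descent starts there. -/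
theorem lifted_of_dir [Nonempty (Fin K)]
    (hP : MixedGraph.CompatibleWithSamePoset (componentMAG P)) {v w : V} (hv : v ∉ C)
    (h₁ : ∃ j h, MixReach P S C (some (j, v)) h)
    (h₂ : MixReach P S C none false ∨ ∀ j, ∃ h, MixReach P S C (some (j, v)) h)
    (e : (unionGraph P).dir v w) : Lifted P S C w true := by
  by_cases hw : w ∈ invariantNodes P
  · rcases h₂ with h₂ | h₂
    · obtain ⟨j, h, hr⟩ := h₁
      exact .inl ⟨h₂, j, hr.edge hv (edge_of_unionGraph_dir e hw j)⟩
    · exact .inr (.inl fun j => (h₂ j).elim fun _ hr =>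
        hr.edge hv (edge_of_unionGraph_dir e hw j))
  rcases h₂ with h₂ | h₂
  · exact .of_none h₂ hw
  obtain ⟨k, ⟨u, hu, hvu, huw⟩ | ⟨hvU, hvw⟩⟩ := unionGraph_dir_cases e hw
  · obtain ⟨h, hr⟩ := h₂ k
    replace hr := hr.edge hv hvu
    by_cases huC : (unionGraph P).IsAncestorOfSet C u
    · exact .of_none
        ((hr.free (isAncestorOfSet_mixtureDAG_of_unionGraph hP hu huC k)).none hu) hw
    · exact .inr (.inr ⟨k, u, hu, huC, reflTransGen_unionGraph huw, hr⟩)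
  · obtain ⟨h, hr⟩ := h₂ k
    cases h with
    | false => exact .of_none (MixFree.none (MixWeak.free (.inl hr) hv) hvU) hw
    | true =>
      by_cases hvC : (unionGraph P).IsAncestorOfSet C v
      · exact .of_none
          ((hr.free (isAncestorOfSet_mixtureDAG_of_unionGraph hP hvU hvC k)).none hvU) hw
      · exact .inr (.inr ⟨k, v, hvU, hvC, .single e, hr⟩)

/-- A child of `y` above `v` that is an ancestor of `C` is entered from `y` as an open collider; one
that is not has a path to `v` clear of `C`, which is climbed from the free copy of `v`. -/
theorem lifted_of_dir_of_free [Nonempty (Fin K)]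
    (hP : MixedGraph.CompatibleWithSamePoset (componentMAG P)) {v w : V}
    (hv : v ∉ invariantNodes P) (h : ∀ j, MixFree P S C j v)
    (e : (unionGraph P).dir w v) : Lifted P S C w false := by
  have hy : MixReach P S C none false := (h (Classical.arbitrary _)).none hv
  refine ⟨?_, .inl hy⟩
  by_cases hw : w ∈ invariantNodes P
  · obtain ⟨k, ⟨u, hu, hwu, huv⟩ | ⟨hw', _⟩⟩ := unionGraph_dir_cases e hv
    · refine ⟨k, .inl (MixFree.edge (v := u) ?_ hwu)⟩
      by_cases huC : (unionGraph P).IsAncestorOfSet C u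
      · exact (MixReach.of_none hy hu k).free
          (isAncestorOfSet_mixtureDAG_of_unionGraph hP hu huC k)
      · exact (h k).path (reflTransGen_edgeAvoiding huC huv)
    · exact (hw' hw).elim
  · obtain ⟨k, hk⟩ := transGen_of_unionGraph_dir e
    refine ⟨k, ?_⟩
    by_cases hwC : (unionGraph P).IsAncestorOfSet C w
    · exact .inr ⟨MixReach.of_none hy hw k,
        isAncestorOfSet_mixtureDAG_of_unionGraph hP hw hwC k⟩
    · exact ((h k).path (reflTransGen_edgeAvoiding hwC hk.to_reflTransGen)).weak

theorem lifted_bwd_of_tail [Nonempty (Fin K)]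
    (hP : MixedGraph.CompatibleWithSamePoset (componentMAG P)) (hSC : Disjoint S C) {v w : V}
    (hr : (unionGraph P).Reach S C v false) (hv : v ∉ C) (hl : Lifted P S C v false)
    (e : (unionGraph P).dir w v) : Lifted P S C w false := by
  obtain ⟨⟨j, hj⟩, hl⟩ := hl
  by_cases hvU : v ∈ invariantNodes P
  · have key : ∀ i, MixWeak P S C i v → MixWeak P S C i w := fun i hi =>
      .inl ((hi.free hv).edge (edge_of_unionGraph_dir e hvU i))
    exact ⟨⟨j, key j hj⟩, hl.imp_right fun h i => key i (h i)⟩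
  have hy : MixReach P S C none false := (hj.free hv).none hvU
  refine lifted_of_dir_of_free hP hvU (fun k => ?_) e
  by_cases hvC : (unionGraph P).IsAncestorOfSet C v
  · exact (MixReach.of_none hy hvU k).free
      (isAncestorOfSet_mixtureDAG_of_unionGraph hP hvU hvC k)
  -- The arrival by a tail now makes `v` an ancestor of some `s ∈ S`. Every copy of `s` is a
  -- starting point, so every copy of `v` is reached by climbing from it.
  · obtain ⟨s, hs, hvs⟩ := (hr.isAncestorOfSet_or rfl).resolve_left hvC
    have hsk : MixFree P S C k s := MixWeak.free
      (.inl (MixedGraph.Reach.base (some_mem_allCopies.2 hs))) (hSC.notMem_of_mem_left hs)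
    exact hsk.path (reflTransGen_edgeAvoiding hvC (reflTransGen_of_unionGraph hP hvU hvs k))

/-- The final descent starts at a non-ancestor of `C`, so it never arrives at a collider that could
be opened. -/
theorem Lifted.cases_of_isAncestorOfSet {v : V} (hl : Lifted P S C v true)
    (hvC : (unionGraph P).IsAncestorOfSet C v) :
    (MixReach P S C none false ∧ ∃ j, MixReach P S C (some (j, v)) true) ∨
      ∀ j, MixReach P S C (some (j, v)) true := by
  rcases hl with hl | hl | ⟨_, u, _, huC, huv, _⟩
  · exact .inl hl
  · exact .inr hl
  · exact (huC (hvC.of_reflTransGen huv)).elim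

theorem Lifted.none_of_isAncestorOfSet [Nonempty (Fin K)]
    (hP : MixedGraph.CompatibleWithSamePoset (componentMAG P)) {v : V}
    (hl : Lifted P S C v true) (hvC : (unionGraph P).IsAncestorOfSet C v)
    (hv : v ∉ invariantNodes P) : MixReach P S C none false := by
  rcases hl.cases_of_isAncestorOfSet hvC with hl | hl
  · exact hl.1
  · exact ((hl (Classical.arbitrary _)).free
      (isAncestorOfSet_mixtureDAG_of_unionGraph hP hv hvC _)).none hv

theorem lifted_bwd_of_head [Nonempty (Fin K)]
    (hP : MixedGraph.CompatibleWithSamePoset (componentMAG P)) {v w : V}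
    (hvC : (unionGraph P).IsAncestorOfSet C v) (hl : Lifted P S C v true)
    (e : (unionGraph P).dir w v) : Lifted P S C w false := by
  by_cases hvU : v ∈ invariantNodes P
  · have edge := edge_of_unionGraph_dir e hvU
    replace hl := hl.cases_of_isAncestorOfSet hvC
    by_cases hall : ∀ j, MixAnc P C j v
    · have key : ∀ i, MixReach P S C (some (i, v)) true → MixWeak P S C i w := fun i hi =>
        .inl ((hi.free (hall i)).edge (edge i))
      rcases hl with ⟨hy, j, hj⟩ | hl
      · exact ⟨⟨j, key j hj⟩, .inl hy⟩
      · exact ⟨⟨Classical.arbitrary _, key _ (hl _)⟩, .inr fun j => key j (hl j)⟩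
    · obtain ⟨j, hj⟩ := not_forall.1 hall
      obtain ⟨k, hk⟩ := exists_mixAnc hP hvC
      -- The copy already reached may be a closed collider, so the walk detours in component `k`:
      -- down to `z` and on to `y` if `y` is not yet reached, then from `y` to `z`, up to `v` and on
      -- to `w`.
      obtain ⟨z, hz, hzC, hvz⟩ := exists_path_of_mixAnc hk hj
      have hy : MixReach P S C none false := by
        rcases hl with hl | hl
        · exact hl.1
        · exact (((hl k).path hvz).free hzC).none hz
      exact ⟨⟨k, .inl ((((MixReach.of_none hy hz k).free hzC).path hvz).edge (edge k))⟩, .inl hy⟩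
  · have hy := hl.none_of_isAncestorOfSet hP hvC hvU
    exact lifted_of_dir_of_free hP hvU (fun k => (MixReach.of_none hy hvU k).free
      (isAncestorOfSet_mixtureDAG_of_unionGraph hP hvU hvC k)) e

theorem lifted_of_reach [Nonempty (Fin K)]
    (hP : MixedGraph.CompatibleWithSamePoset (componentMAG P)) (hSC : Disjoint S C) {v : V}
    {h : Bool} (hv : (unionGraph P).Reach S C v h) : Lifted P S C v h := by
  induction hv with
  | base hs =>
    have key : ∀ j, MixWeak P S C j _ := fun j =>
      .inl (MixedGraph.Reach.base (some_mem_allCopies.2 hs))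
    exact ⟨⟨Classical.arbitrary _, key _⟩, .inr key⟩
  | @fwd v w h hr hC e ih =>
    cases h with
    | false =>
      obtain ⟨⟨j, hj⟩, ih⟩ := ih
      exact lifted_of_dir hP hC ⟨j, hj.exists_reach⟩
        (ih.imp_right fun h j => (h j).exists_reach) e
    | true =>
      rcases ih with ⟨hy, j, hj⟩ | ih | ⟨j, u, hu, huC, huv, hj⟩
      · exact lifted_of_dir hP hC ⟨j, _, hj⟩ (.inl hy) e
      · exact lifted_of_dir hP hC ⟨Classical.arbitrary _, _, ih _⟩ (.inr fun j => ⟨_, ih j⟩) e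
      · exact .inr (.inr ⟨j, u, hu, huC, huv.tail e, hj⟩)
  | @bwd v w h hr hC e ih =>
    cases h with
    | false => exact lifted_bwd_of_tail hP hSC hr hC ih e
    | true => exact lifted_bwd_of_head hP hC ih e
  | @bi v w h hr hC e ih =>
    obtain ⟨hv, hw⟩ := unionGraph_bi_notMem e
    refine .of_none ?_ hw
    cases h with
    | false =>
      obtain ⟨⟨j, hj⟩, -⟩ := ih
      exact (hj.free hC).none hv
    | true => exact ih.none_of_isAncestorOfSet hP hC hv

end DAGModel

/-! ### The equivalence -/

theorem mainTheorem2 {V : Type*} [Finite V] {X : V → Type*} [∀ v, MeasurableSpace (X v)]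
    {K : ℕ} (P : Fin K → DAGModel X)
    (hP : MixedGraph.CompatibleWithSamePoset (DAGModel.componentMAG P))
    (A B C : Set V) (hAB : Disjoint A B) (hAC : Disjoint A C) (hBC : Disjoint B C) :
    (DAGModel.unionGraph P).DSep A B C ↔
      (DAGModel.mixtureDAG P).toMixedGraph.DSep
        (allCopies K A) (allCopies K B) (allCopies K C) := by
  rw [MixedGraph.dSep_iff_not_reach _ hBC,
    MixedGraph.dSep_iff_not_reach _ (DAGModel.disjoint_allCopies hBC)]
  constructor
  · rintro H _ ⟨j, a, ha, rfl⟩ h hr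
    obtain ⟨h', hr'⟩ :=
      (DAGModel.projected_of_reach hP hr).exists_reach (hAC.notMem_of_mem_left ha)
    exact H a ha h' hr'
  · intro H a ha h hr
    -- `K = 0` is allowed. As `A` and `B` are disjoint, the walk has an edge, and this edge belongs
    -- to some component.
    have : Nonempty (Fin K) := by
      cases hr with
      | base ha' => exact (hAB.notMem_of_mem_left ha ha').elim
      | fwd _ _ e => exact ⟨e.choose⟩
      | bwd _ _ e => exact ⟨e.choose⟩
      | bi _ _ e => exact ⟨e.choose⟩
    obtain ⟨j, h', hr'⟩ := (DAGModel.lifted_of_reach hP hBC hr).exists_reach hP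
    exact H _ (DAGModel.some_mem_allCopies.2 ha) h' hr'
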